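/- Let $M$ be a smooth ($C^\infty$) manifold without boundary, of dimension $n$, equipped with a smooth Riemannian metric; balls $B_r(a)$ and the Hausdorff measure $\mathcal H^k$ are taken with respect to the Riemannian distance. Let $k \ge 0$ and let $T$ be a $k$-dimensional current on $M$, that is, a continuous complex-linear functional on the space of smooth complex-valued $k$-forms with compact support in $M$. For an open set $U \subset M$ let $$\|T\|(U) = \sup\{\, |T(\varphi)| : \varphi \text{ a smooth } k\text{-form with compact support in } U,\ \text{of comass} \le 1 \text{ at every point}\,\},$$ (the comass of $\alpha\in\Lambda^k T_x^*M\otimes\mathbb C$ is $\sup|\alpha(v_1,\dots,v_k)|$ over orthonormal $v_1,\dots,v_k\in T_xM$), and for $A \subset M$ arbitrary let $\|T\|(A) = \inf\{\|T\|(U) : U \supset A \text{ open}\}$. Let $\partial T(\varphi) = T(d\varphi)$ (with $\partial T = 0$ if $k=0$), and let $\operatorname{spt}(T)$ be the complement of the largest open set on which $T$ vanishes. Suppose that $T$ is locally normal, i.e. every point of $M$ has an open neighbourhood of finite $\|T\|$-mass and one of finite $\|\partial T\|$-mass. Suppose further that there is a constant $c > 0$ such that for $\mathcal H^k$-almost every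 $a \in \operatorname{spt}(T)$ the $k$-density $$\Theta^k(\|T\|, a) = \lim_{r \downarrow 0} \frac{\|T\|(B_r(a))}{\Omega(k)\, r^k} \in [0,\infty]$$ exists and is at least $c$, where $\Omega(k)$ is the volume of the unit ball of $\mathbb R^k$. Then $\operatorname{spt}(T)$ is $\mathcal H^k$-locally finite: it is $\mathcal H^k$-measurable, and every $a \in M$ has an open neighbourhood $V$ with $\mathcal H^k(V \cap \operatorname{spt}(T)) < \infty$. -/

import Mathlib

open Set Filter Topology MeasureTheory Manifold Bundle
open scoped ENNReal ContDiff

noncomputable section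

/-! ## Differential forms on a manifold without boundary modelled on a normed space `E` -/

section Forms

/-- A complex-valued differential `k`-form on `M`, with no regularity required. -/
abbrev RoughForm (E M : Type*) [NormedAddCommGroup E] [NormedSpace ℝ E]
    [TopologicalSpace M] [ChartedSpace E M] (k : ℕ) : Type _ :=
  ∀ x : M, TangentSpace 𝓘(ℝ, E) x [⋀^Fin k]→L[ℝ] ℂ

variable {E M : Type*} [NormedAddCommGroup E] [NormedSpace ℝ E]
  [TopologicalSpace M] [ChartedSpace E M] {k : ℕ}

namespace RoughForm

/-- The coordinate expression of `φ` in the chart `e`, i.e. the pullback of `φ` by `e⁻¹`.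
It is meaningful on `e.target`. -/
def inChart (φ : RoughForm E M k) (e : OpenPartialHomeomorph M E) (y : E) :
    E [⋀^Fin k]→L[ℝ] ℂ :=
  (φ (e.symm y)).compContinuousLinearMap (mfderiv 𝓘(ℝ, E) 𝓘(ℝ, E) e.symm y)

/-- A form is smooth if all its coordinate expressions are smooth. -/
def Smooth (φ : RoughForm E M k) : Prop :=
  ∀ e ∈ atlas E M, ContDiffOn ℝ ∞ (φ.inChart e) e.target

/-- The support of a form. -/
def supp (φ : RoughForm E M k) : Set M := closure {x | φ x ≠ 0}

/-- The exterior derivative. At `x` it is computed in the preferred chart at `x`;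
`inChart_extDeriv` shows that every other chart gives the same result. -/
def extDeriv (φ : RoughForm E M k) : RoughForm E M (k + 1) := fun x =>
  (_root_.extDeriv (φ.inChart (chartAt E x)) (chartAt E x x)).compContinuousLinearMap
    (mfderiv 𝓘(ℝ, E) 𝓘(ℝ, E) (chartAt E x) x)

lemma inChart_add (φ ψ : RoughForm E M k) (e : OpenPartialHomeomorph M E) :
    (φ + ψ).inChart e = φ.inChart e + ψ.inChart e := rfl

lemma inChart_smul (c : ℂ) (φ : RoughForm E M k) (e : OpenPartialHomeomorph M E) :
    (c • φ).inChart e = c • φ.inChart e := rfl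

/-- Pullback of a form by a map from `E`, at a point, depends only on the germ of the map. -/
lemma pullback_congr (φ : RoughForm E M k) {f g : E → M} {y : E} (h : f =ᶠ[𝓝 y] g) :
    ((φ (f y)).compContinuousLinearMap (mfderiv 𝓘(ℝ, E) 𝓘(ℝ, E) f y) : E [⋀^Fin k]→L[ℝ] ℂ) =
      (φ (g y)).compContinuousLinearMap (mfderiv 𝓘(ℝ, E) 𝓘(ℝ, E) g y) := by
  let φ' : M → E [⋀^Fin k]→L[ℝ] ℂ := φ
  let A : E →L[ℝ] E := mfderiv 𝓘(ℝ, E) 𝓘(ℝ, E) f y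
  let B : E →L[ℝ] E := mfderiv 𝓘(ℝ, E) 𝓘(ℝ, E) g y
  have hAB : A = B := h.mfderiv_eq
  change (φ' (f y)).compContinuousLinearMap A = (φ' (g y)).compContinuousLinearMap B
  rw [hAB, h.eq_of_nhds]

/-- Pullback of forms is functorial. -/
lemma pullback_comp (φ : RoughForm E M k) {f : E → M} {g : E → E} {y : E}
    (hf : MDifferentiableAt 𝓘(ℝ, E) 𝓘(ℝ, E) f (g y)) (hg : DifferentiableAt ℝ g y) :
    ((φ ((f ∘ g) y)).compContinuousLinearMap
        (mfderiv 𝓘(ℝ, E) 𝓘(ℝ, E) (f ∘ g) y) : E [⋀^Fin k]→L[ℝ] ℂ) =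
      ((φ (f (g y))).compContinuousLinearMap
        (mfderiv 𝓘(ℝ, E) 𝓘(ℝ, E) f (g y)) : E [⋀^Fin k]→L[ℝ] ℂ).compContinuousLinearMap
        (fderiv ℝ g y) := by
  have h := mfderiv_comp y hf hg.mdifferentiableAt
  rw [h, mfderiv_eq_fderiv]
  rfl

/-- The exterior derivative may be computed in any chart. -/
lemma inChart_extDeriv [IsManifold 𝓘(ℝ, E) ∞ M] {φ : RoughForm E M k} (hφ : φ.Smooth) {e : OpenPartialHomeomorph M E}
    (he : e ∈ atlas E M) {y : E} (hy : y ∈ e.target) :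
    φ.extDeriv.inChart e y = _root_.extDeriv (φ.inChart e) y := by
  have hsub := StructureGroupoid.subset_maximalAtlas (contDiffGroupoid ∞ 𝓘(ℝ, E)) (M := M)
  set c := chartAt E (e.symm y) with hc
  have hcat : c ∈ atlas E M := chart_mem_atlas E _
  have hyc : e.symm y ∈ c.source := mem_chart_source E _
  set f : E → E := c ∘ e.symm with hf
  -- near `y`, the transition map is smooth
  have hnhds : ∀ᶠ z in 𝓝 y, z ∈ e.target ∧ e.symm z ∈ c.source :=
    Filter.Eventually.and (e.open_target.mem_nhds hy)
      ((e.continuousAt_symm hy).preimage_mem_nhds (c.open_source.mem_nhds hyc))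
  have hfs : ∀ z, z ∈ e.target ∧ e.symm z ∈ c.source → ContDiffAt ℝ ∞ f z := by
    intro z hz
    have h1 : ContMDiffAt 𝓘(ℝ, E) 𝓘(ℝ, E) ∞ c (e.symm z) :=
      contMDiffAt_of_mem_maximalAtlas (hsub hcat) hz.2
    have h2 : ContMDiffAt 𝓘(ℝ, E) 𝓘(ℝ, E) ∞ e.symm z :=
      contMDiffAt_symm_of_mem_maximalAtlas (hsub he) hz.1
    exact (h1.comp z h2).contDiffAt
  have hy' := hnhds.self_of_nhds
  have hce : MDifferentiableAt 𝓘(ℝ, E) 𝓘(ℝ, E) c (e.symm y) := mdifferentiableAt_atlas hcat hyc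
  have hes : MDifferentiableAt 𝓘(ℝ, E) 𝓘(ℝ, E) e.symm y := mdifferentiableAt_atlas_symm he hy
  -- the coordinate expression in `e` is the pullback of the one in `c`
  have hpull : φ.inChart e =ᶠ[𝓝 y]
      fun z => (φ.inChart c (f z)).compContinuousLinearMap (fderiv ℝ f z) := by
    filter_upwards [eventually_eventually_nhds.2 hnhds] with z hz
    have hz' := hz.self_of_nhds
    have hg : e.symm =ᶠ[𝓝 z] c.symm ∘ f := by
      filter_upwards [hz] with w hw
      exact (c.left_inv hw.2).symm
    have hfz : f z ∈ c.target := c.map_source hz'.2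
    exact (φ.pullback_congr hg).trans
      (φ.pullback_comp (mdifferentiableAt_atlas_symm hcat hfz)
        ((hfs z hz').differentiableAt (by simp)))
  have hfy : f y ∈ c.target := c.map_source hy'.2
  have hd : DifferentiableAt ℝ (φ.inChart c) (f y) :=
    ((hφ c hcat).contDiffAt (c.open_target.mem_nhds hfy)).differentiableAt (by simp)
  rw [hpull.extDeriv_eq, extDeriv_pullback hd (hfs y hy') (by simpa using WithTop.coe_le_coe.2 (le_top : (2 : ℕ∞) ≤ ⊤))]
  have hcomp := mfderiv_comp y hce hes
  have hff : (fderiv ℝ f y : E →L[ℝ] E) = mfderiv 𝓘(ℝ, E) 𝓘(ℝ, E) (c ∘ e.symm) y := by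
    rw [mfderiv_eq_fderiv]
  rw [hff, hcomp]
  rfl

set_option synthInstance.maxHeartbeats 200000 in
lemma Smooth.extDeriv [IsManifold 𝓘(ℝ, E) ∞ M] {φ : RoughForm E M k} (hφ : φ.Smooth) :
    φ.extDeriv.Smooth := by
  intro e he
  have h1 : ContDiffOn ℝ ∞ (fderiv ℝ (φ.inChart e)) e.target :=
    (hφ e he).fderiv_of_isOpen e.open_target (by simp)
  refine (((ContinuousAlternatingMap.alternatizeUncurryFinCLM ℝ E ℂ (n := k)).contDiff).comp_contDiffOn
    h1).congr fun y hy => ?_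
  exact inChart_extDeriv hφ he hy

lemma Smooth.differentiableAt_inChart {φ : RoughForm E M k} (hφ : φ.Smooth) (x : M) :
    DifferentiableAt ℝ (φ.inChart (chartAt E x)) (chartAt E x x) :=
  ((hφ _ (chart_mem_atlas E x)).contDiffAt
    ((chartAt E x).open_target.mem_nhds (mem_chart_target E x))).differentiableAt (by simp)

lemma extDeriv_add {φ ψ : RoughForm E M k} (hφ : φ.Smooth) (hψ : ψ.Smooth) :
    (φ + ψ).extDeriv = φ.extDeriv + ψ.extDeriv := by
  funext x
  simp only [RoughForm.extDeriv, inChart_add, Pi.add_apply]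
  rw [_root_.extDeriv_add (hφ.differentiableAt_inChart x) (hψ.differentiableAt_inChart x)]
  rfl

lemma extDeriv_smul (c : ℂ) {φ : RoughForm E M k} (hφ : φ.Smooth) :
    (c • φ).extDeriv = c • φ.extDeriv := by
  funext x
  simp only [RoughForm.extDeriv, inChart_smul, Pi.smul_apply]
  have h : _root_.extDeriv (c • φ.inChart (chartAt E x)) (chartAt E x x) =
      c • _root_.extDeriv (φ.inChart (chartAt E x)) (chartAt E x x) := by
    ext v
    rw [_root_.extDeriv, _root_.extDeriv, fderiv_const_smul (hφ.differentiableAt_inChart x)]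
    simp only [ContinuousAlternatingMap.alternatizeUncurryFin_apply,
      ContinuousAlternatingMap.smul_apply, Finset.smul_sum]
    refine Finset.sum_congr rfl fun i _ => ?_
    rw [smul_comm]
    rfl
  rw [h]
  rfl

set_option synthInstance.maxHeartbeats 200000 in
lemma supp_extDeriv_subset (φ : RoughForm E M k) : φ.extDeriv.supp ⊆ φ.supp := by
  refine closure_minimal (fun x hx => ?_) isClosed_closure
  by_contra hxs
  apply hx
  have h1 : ∀ᶠ y in 𝓝 (chartAt E x x), (chartAt E x).symm y ∉ φ.supp := by
    have hc := (chartAt E x).continuousAt_symm (mem_chart_target E x)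
    refine hc.preimage_mem_nhds (t := φ.suppᶜ) ?_
    rw [(chartAt E x).left_inv (mem_chart_source E x)]
    exact isClosed_closure.isOpen_compl.mem_nhds hxs
  have h2 : φ.inChart (chartAt E x) =ᶠ[𝓝 (chartAt E x x)] fun _ => 0 := by
    filter_upwards [h1] with y hy
    have : φ ((chartAt E x).symm y) = 0 := by
      by_contra h
      exact hy (subset_closure h)
    rw [inChart, this]
    rfl
  rw [RoughForm.extDeriv, h2.extDeriv_eq]
  have h3 : _root_.extDeriv (fun _ : E => (0 : E [⋀^Fin k]→L[ℝ] ℂ)) (chartAt E x x) = 0 := by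
    rw [_root_.extDeriv, fderiv_fun_const]
    exact map_zero (ContinuousAlternatingMap.alternatizeUncurryFinCLM ℝ E ℂ (n := k))
  rw [h3]
  rfl

end RoughForm

end Forms

/-! ## Test forms and currents -/

section Currents

variable (E M : Type*) [NormedAddCommGroup E] [NormedSpace ℝ E]
  [TopologicalSpace M] [ChartedSpace E M]

/-- The complex vector space of smooth complex-valued `k`-forms with compact support. -/
def testForms (k : ℕ) : Submodule ℂ (RoughForm E M k) where
  carrier := {φ | φ.Smooth ∧ IsCompact φ.supp}
  zero_mem' := by
    refine ⟨fun e _ => contDiffOn_const (c := 0), ?_⟩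
    simp [RoughForm.supp]
  add_mem' := by
    rintro φ ψ ⟨h1, h2⟩ ⟨h3, h4⟩
    refine ⟨fun e he => (h1 e he).add (h3 e he), (h2.union h4).of_isClosed_subset
      isClosed_closure (closure_minimal (fun x hx => ?_) (isClosed_closure.union isClosed_closure))⟩
    by_cases h : φ x = 0
    · refine Or.inr (subset_closure fun h' => hx ?_)
      rw [Pi.add_apply, h, h', add_zero]
    · exact Or.inl (subset_closure h)
  smul_mem' := by
    rintro c φ ⟨h1, h2⟩
    refine ⟨fun e he => (h1 e he).const_smul c, h2.of_isClosed_subset isClosed_closure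
      (closure_mono fun x hx h => hx ?_)⟩
    rw [Pi.smul_apply, h]
    ext v
    simp

variable {E M}

/-- Exterior differentiation of test forms. -/
def testForms.d [IsManifold 𝓘(ℝ, E) ∞ M] (k : ℕ) :
    testForms E M k →ₗ[ℂ] testForms E M (k + 1) where
  toFun φ := ⟨φ.1.extDeriv, φ.2.1.extDeriv,
    φ.2.2.of_isClosed_subset isClosed_closure φ.1.supp_extDeriv_subset⟩
  map_add' φ ψ := Subtype.ext (RoughForm.extDeriv_add φ.2.1 ψ.2.1)
  map_smul' c φ := Subtype.ext (RoughForm.extDeriv_smul c φ.2.1)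

/-- Convergence to zero of a sequence of test forms: the supports stay in a fixed compact set and,
in every chart, all derivatives of the coordinate expressions converge to zero uniformly on compact
sets. -/
def testForms.TendstoZero {k : ℕ} (φ : ℕ → testForms E M k) : Prop :=
  (∃ K : Set M, IsCompact K ∧ ∀ j, (φ j).1.supp ⊆ K) ∧
  ∀ e ∈ atlas E M, ∀ C ⊆ e.target, IsCompact C → ∀ m : ℕ,
    TendstoUniformlyOn (fun j y => ‖iteratedFDeriv ℝ m ((φ j).1.inChart e) y‖) 0 atTop C

variable (E M) in
/-- A current of dimension `k`: a continuous linear functional on the space of test `k`-forms. -/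
structure Current (k : ℕ) where
  /-- the underlying linear functional -/
  toLinearMap : testForms E M k →ₗ[ℂ] ℂ
  /-- continuity for the usual (LF) topology on test forms -/
  tendsto_zero : ∀ φ : ℕ → testForms E M k, testForms.TendstoZero φ →
    Tendsto (fun j => toLinearMap (φ j)) atTop (𝓝 0)

lemma norm_iteratedFDeriv_comp_fderiv_le {F G : Type*} [NormedAddCommGroup F] [NormedSpace ℝ F]
    [NormedAddCommGroup G] [NormedSpace ℝ G] (L : (E →L[ℝ] F) →L[ℝ] G) :
    ∃ C : ℝ, 0 < C ∧ ∀ (f : E → F) (y : E) (m : ℕ), ContDiffAt ℝ ∞ f y →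
      ‖iteratedFDeriv ℝ m (L ∘ fderiv ℝ f) y‖ ≤ C * ‖iteratedFDeriv ℝ (m + 1) f y‖ := by
  refine ⟨‖L‖ + 1, by positivity, fun f y m hf => ?_⟩
  have hsm : ContDiffAt ℝ m (fderiv ℝ f) y :=
    hf.fderiv_right (m := m) (WithTop.coe_le_coe.2 (le_top : ((m + 1 : ℕ) : ℕ∞) ≤ ⊤))
  refine (L.norm_iteratedFDeriv_comp_left hsm le_rfl).trans ?_
  rw [norm_iteratedFDeriv_fderiv]
  gcongr
  linarith

/-- Exterior differentiation is continuous. -/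
lemma testForms.TendstoZero.d [IsManifold 𝓘(ℝ, E) ∞ M] {k : ℕ} {φ : ℕ → testForms E M k}
    (h : TendstoZero φ) : TendstoZero fun j => testForms.d k (φ j) := by
  obtain ⟨⟨K, hK, hφK⟩, hu⟩ := h
  refine ⟨⟨K, hK, fun j => (φ j).1.supp_extDeriv_subset.trans (hφK j)⟩, ?_⟩
  intro e he C hC hCc m
  have h1 := hu e he C hC hCc (m + 1)
  obtain ⟨B, hB, hL⟩ := norm_iteratedFDeriv_comp_fderiv_le
    (ContinuousAlternatingMap.alternatizeUncurryFinCLM ℝ E ℂ (n := k))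
  have key : ∀ j, ∀ y ∈ C, ‖iteratedFDeriv ℝ m ((testForms.d k (φ j)).1.inChart e) y‖ ≤
      B * ‖iteratedFDeriv ℝ (m + 1) ((φ j).1.inChart e) y‖ := by
    intro j y hy
    have hyt := e.open_target.mem_nhds (hC hy)
    refine le_of_eq_of_le ?_ (hL _ y m (((φ j).2.1 e he).contDiffAt hyt))
    congr 1
    refine Filter.EventuallyEq.eq_of_nhds (Filter.EventuallyEq.iteratedFDeriv ℝ ?_ m)
    filter_upwards [hyt] with z hz
    exact RoughForm.inChart_extDeriv (φ j).2.1 he hz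
  rw [Metric.tendstoUniformlyOn_iff] at h1 ⊢
  intro ε hε
  filter_upwards [h1 (ε / B) (div_pos hε hB)] with j hj y hy
  have h2 := hj y hy
  simp only [Pi.zero_apply, dist_zero_left, norm_norm] at h2 ⊢
  rw [lt_div_iff₀ hB, mul_comm] at h2
  exact (key j y hy).trans_lt h2

namespace Current

variable {k : ℕ}

/-- The boundary of a current, `(∂T)(φ) = T(dφ)`. -/
def boundary [IsManifold 𝓘(ℝ, E) ∞ M] (T : Current E M (k + 1)) : Current E M k where
  toLinearMap := T.toLinearMap ∘ₗ testForms.d k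
  tendsto_zero _ h := T.tendsto_zero _ h.d

/-- The support of a current: the complement of the largest open set on which it vanishes. -/
def support (T : Current E M k) : Set M :=
  {a | ∀ U : Set M, IsOpen U → a ∈ U →
    ∃ φ : testForms E M k, φ.1.supp ⊆ U ∧ T.toLinearMap φ ≠ 0}

end Current

end Currents

/-! ## Mass and density, for a Riemannian metric on `M` -/

section Mass

variable {E M : Type*} [NormedAddCommGroup E] [NormedSpace ℝ E]
  [TopologicalSpace M] [ChartedSpace E M]
  [RiemannianBundle (fun x : M => TangentSpace 𝓘(ℝ, E) x)] {k : ℕ}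

/-- The comass of a `k`-covector at `x`: its supremum on simple unit `k`-vectors
`v₁ ∧ ⋯ ∧ v_k` (with `v₁, …, v_k` orthonormal for the Riemannian metric). -/
def comass {x : M} (α : TangentSpace 𝓘(ℝ, E) x [⋀^Fin k]→L[ℝ] ℂ) : ℝ≥0∞ :=
  ⨆ (v : Fin k → TangentSpace 𝓘(ℝ, E) x) (_ : Orthonormal ℝ v), ‖α v‖ₑ

namespace Current

/-- The mass of `T` in an open set `U`: the supremum of `|T(φ)|` over the test forms `φ` supported
in `U` with comass at most one everywhere. -/
def massOn (T : Current E M k) (U : Set M) : ℝ≥0∞ :=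
  ⨆ (φ : testForms E M k) (_ : φ.1.supp ⊆ U) (_ : ∀ x, comass (φ.1 x) ≤ 1), ‖T.toLinearMap φ‖ₑ

/-- The mass (total variation) measure `‖T‖`: on open sets it is `massOn`, and it is extended to
arbitrary sets by outer regularity. -/
def massMeasure (T : Current E M k) (A : Set M) : ℝ≥0∞ :=
  ⨅ (U : Set M) (_ : IsOpen U) (_ : A ⊆ U), T.massOn U

/-- `T` has locally finite mass. -/
def LocallyFiniteMass (T : Current E M k) : Prop :=
  ∀ a : M, ∃ V : Set M, IsOpen V ∧ a ∈ V ∧ T.massMeasure V < ⊤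

/-- `T` is locally normal: `T` and its boundary have locally finite mass
(the boundary of a `0`-dimensional current is zero). -/
def LocallyNormal [IsManifold 𝓘(ℝ, E) ∞ M] : {k : ℕ} → Current E M k → Prop
  | 0, T => T.LocallyFiniteMass
  | _ + 1, T => T.LocallyFiniteMass ∧ T.boundary.LocallyFiniteMass

end Current

end Mass

section Density

/-- The `k`-density `Θᵏ(‖T‖, a)` exists and equals `θ`:
`‖T‖(B_r(a)) / (Ω(k) rᵏ) → θ` as `r ↓ 0`, where `Ω(k)` is the volume of the unit ball of `ℝᵏ`. -/
def Current.HasDensity {E M : Type*} [NormedAddCommGroup E] [NormedSpace ℝ E]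
    [EMetricSpace M] [ChartedSpace E M]
    [RiemannianBundle (fun x : M => TangentSpace 𝓘(ℝ, E) x)] {k : ℕ}
    (T : Current E M k) (a : M) (θ : ℝ≥0∞) : Prop :=
  Tendsto (fun r : ℝ => T.massMeasure (Metric.eball a (ENNReal.ofReal r)) /
      (volume (Metric.ball (0 : EuclideanSpace ℝ (Fin k)) 1) * ENNReal.ofReal (r ^ k)))
    (𝓝[>] 0) (𝓝 θ)

/-- `A` is `ℋᵏ`-measurable and every point of `M` has an open neighbourhood `V` with
`ℋᵏ(V ∩ A) < ∞`. The measure `μH[k]` is `ℋᵏ` up to a positive constant factor. -/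
def HausdorffLocallyFinite {M : Type*} [EMetricSpace M] [MeasurableSpace M] [BorelSpace M]
    (k : ℕ) (A : Set M) : Prop :=
  (μH[(k : ℝ)] : Measure M).toOuterMeasure.IsCaratheodory A ∧
    ∀ a : M, ∃ V : Set M, IsOpen V ∧ a ∈ V ∧ μH[(k : ℝ)] (V ∩ A) < ⊤

end Density

end

/-! The heart is a Vitali covering estimate. Let `V` be an open set of finite mass and `A` the set
of points of `V` with density at least `c`. Around each point of `A`, all sufficiently small balls
of radius `r` carry mass at least `C * r ^ k`, where `C` is `c / 2` times the volume of the unit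
ball. At every scale, disjoint balls of this kind can be chosen inside `V` whose threefold
enlargements cover `A`. Disjointness bounds the sum of `C * r ^ k` by the mass of `V`, so `A` has
Hausdorff measure at most `6 ^ k * C⁻¹` times that mass. Almost every point of the support in `V`
lies in `A`.

The argument needs only finite superadditivity of mass on disjoint open sets
(`Current.massOn_add_le`, `Current.sum_massOn_le`), not that mass is a measure. Measurability is
automatic, as the support is closed. -/

/-! ### The covering estimate for a superadditive set function -/

lemma hausdorffMeasure_lt_top_of_superadditive {X : Type*} [EMetricSpace X] [MeasurableSpace X]
    [BorelSpace X] (k : ℕ) (ν : Set X → ℝ≥0∞) {V A : Set X} {C : ℝ≥0∞} (hV : IsOpen V)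
    (hC : C ≠ 0) (hνV : ν V < ⊤) (hAV : A ⊆ V)
    (hν : ∀ (F : Finset X) (U : X → Set X), (F : Set X).PairwiseDisjoint U →
      (∀ i ∈ F, IsOpen (U i) ∧ U i ⊆ V) → ∑ i ∈ F, ν (U i) ≤ ν V)
    (hA : ∀ a ∈ A, ∀ᶠ r : ℝ in 𝓝[>] 0,
      C * ENNReal.ofReal r ^ k ≤ ν (Metric.eball a (ENNReal.ofReal r))) :
    μH[(k : ℝ)] A < ⊤ := by
  -- Scale `n` of the covering: centres `u` of disjoint balls of radius at most `1 / (n + 1)`. The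
  -- factor 3, rather than Vitali's usual 5, suffices because only the points of `A`, the centres of
  -- the balls, have to be covered.
  have hcover : ∀ n : ℕ, ∃ (u : Set X) (r : X → ℝ), u.Countable ∧
      (∀ b ∈ u, r b ≤ 1 / ((n : ℝ) + 1)) ∧
      A ⊆ ⋃ b : u, Metric.eball (b : X) (3 * ENNReal.ofReal (r b)) ∧
      ∑' b : u, C * ENNReal.ofReal (r b) ^ k ≤ ν V := by
    intro n
    have hr : ∀ a ∈ A, ∃ r : ℝ, 0 < r ∧ r ≤ 1 / ((n : ℝ) + 1) ∧
        Metric.eball a (ENNReal.ofReal r) ⊆ V ∧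
        C * ENNReal.ofReal r ^ k ≤ ν (Metric.eball a (ENNReal.ofReal r)) := by
      intro a ha
      obtain ⟨ε, hε, hεV⟩ := EMetric.isOpen_iff.1 hV a (hAV ha)
      have hsmall : ∀ᶠ r : ℝ in 𝓝[>] 0, ENNReal.ofReal r < ε := by
        refine nhdsWithin_le_nhds ?_
        have h0 : Tendsto ENNReal.ofReal (𝓝 0) (𝓝 0) := by
          simpa using ENNReal.tendsto_ofReal (tendsto_id (x := 𝓝 (0 : ℝ)))
        exact h0.eventually (gt_mem_nhds hε)
      have hle : ∀ᶠ r : ℝ in 𝓝[>] 0, r ≤ 1 / ((n : ℝ) + 1) :=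
        nhdsWithin_le_nhds (ge_mem_nhds (by positivity))
      obtain ⟨r, h1, h2, h3, h4⟩ :=
        ((hA a ha).and (hsmall.and (hle.and self_mem_nhdsWithin))).exists
      exact ⟨r, h4, h3, (Metric.eball_subset_eball h2.le).trans hεV, h1⟩
    choose! r hr0 hrn hrV hrν using hr
    -- With ratio 2, every ball of the family meets a selected one of at least half its radius.
    obtain ⟨u, huA, hdisj, hcov⟩ := Vitali.exists_disjoint_subfamily_covering_enlargement
      (fun a => Metric.eball a (ENNReal.ofReal (r a))) A r 2 one_lt_two
      (fun a ha => (hr0 a ha).le) _ hrn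
      (fun a ha => ⟨a, Metric.mem_eball_self (ENNReal.ofReal_pos.2 (hr0 a ha))⟩)
    have hsum : ∑' b : u, C * ENNReal.ofReal (r b) ^ k ≤ ν V := by
      rw [ENNReal.tsum_eq_iSup_sum]
      refine iSup_le fun F => ?_
      have hFu : ∀ b ∈ F.map (Function.Embedding.subtype (· ∈ u)), b ∈ u := by
        intro b hb
        obtain ⟨c, -, rfl⟩ := Finset.mem_map.1 hb
        exact c.2
      calc ∑ b ∈ F, C * ENNReal.ofReal (r b) ^ k
          ≤ ∑ b ∈ F, ν (Metric.eball (b : X) (ENNReal.ofReal (r b))) :=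
            Finset.sum_le_sum fun b _ => hrν b (huA b.2)
        _ = ∑ b ∈ F.map (Function.Embedding.subtype (· ∈ u)),
              ν (Metric.eball b (ENNReal.ofReal (r b))) := by
            rw [Finset.sum_map]
            rfl
        _ ≤ ν V := hν _ _ (hdisj.subset hFu)
            fun b hb => ⟨Metric.isOpen_eball, hrV b (huA (hFu b hb))⟩
    refine ⟨u, r, ?_, fun b hb => hrn b (huA hb), ?_, hsum⟩
    -- A family with finite sum has countably many nonzero terms, and here every term is positive.
    · have hsupp := Summable.countable_support_ennreal (hsum.trans_lt hνV).ne
      have huniv : Function.support (fun b : u => C * ENNReal.ofReal (r b) ^ k) = univ := by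
        ext b
        have := hr0 b (huA b.2)
        simp [hC, this]
      rw [huniv] at hsupp
      exact Set.countable_coe_iff.1 (Set.countable_univ_iff.1 hsupp)
    · intro a ha
      obtain ⟨b, hb, ⟨y, hya, hyb⟩, hab⟩ := hcov a ha
      refine mem_iUnion.2 ⟨⟨b, hb⟩, ?_⟩
      have hab' : ENNReal.ofReal (r a) ≤ 2 * ENNReal.ofReal (r b) := by
        have := ENNReal.ofReal_le_ofReal hab
        rwa [ENNReal.ofReal_mul zero_le_two, ENNReal.ofReal_ofNat] at this
      rw [Metric.mem_eball] at hya hyb ⊢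
      rw [edist_comm] at hya
      calc edist a b ≤ edist a y + edist y b := edist_triangle _ _ _
        _ < ENNReal.ofReal (r a) + ENNReal.ofReal (r b) := ENNReal.add_lt_add hya hyb
        _ ≤ 2 * ENNReal.ofReal (r b) + ENNReal.ofReal (r b) := by gcongr
        _ = 3 * ENNReal.ofReal (r b) := by ring
  choose u r hu hrn hcov hsum using hcover
  have : ∀ n, Countable (u n) := fun n => (hu n).to_subtype
  have hlim : Tendsto (fun n : ℕ => 6 * ENNReal.ofReal (1 / ((n : ℝ) + 1))) atTop (𝓝 0) := by
    have h := ENNReal.Tendsto.const_mul (a := 6)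
      (ENNReal.tendsto_ofReal tendsto_one_div_add_atTop_nhds_zero_nat) (Or.inr (by simp))
    simpa using h
  have hdiam : ∀ n (b : u n), Metric.ediam (Metric.eball (b : X) (3 * ENNReal.ofReal (r n b))) ≤
      6 * ENNReal.ofReal (r n b) := fun n b =>
    Metric.ediam_eball_le.trans_eq (by ring)
  have hbound := Measure.hausdorffMeasure_le_liminf_tsum (k : ℝ) A _ hlim
    (fun n (b : u n) => Metric.eball (b : X) (3 * ENNReal.ofReal (r n b)))
    (Eventually.of_forall fun n b => (hdiam n b).trans
      (by gcongr; exact hrn n b b.2))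
    (Eventually.of_forall hcov)
  have hCtop : (6 : ℝ≥0∞) ^ k * (C⁻¹ * ν V) < ⊤ :=
    ENNReal.mul_lt_top (ENNReal.pow_lt_top (by simp))
      (ENNReal.mul_lt_top (ENNReal.inv_lt_top.2 (pos_iff_ne_zero.2 hC)) hνV)
  refine (hbound.trans (liminf_le_of_frequently_le' (Frequently.of_forall fun n => ?_))).trans_lt
    hCtop
  -- If `C = ⊤`, then `C⁻¹ * C` does not cancel. Finiteness of `ν V` then forces every `r ^ k` to
  -- vanish, so the sum of the diameters' powers is zero.
  by_cases hC' : C = ⊤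
  · have hk : ∀ b : u n, ENNReal.ofReal (r n b) ^ k = 0 := by
      intro b
      by_contra h
      have h1 := (ENNReal.le_tsum (f := fun b : u n => C * ENNReal.ofReal (r n b) ^ k) b).trans
        (hsum n)
      rw [hC', ENNReal.top_mul h] at h1
      exact hνV.not_ge h1
    refine le_of_eq_of_le (ENNReal.tsum_eq_zero.2 fun b => ?_) zero_le
    rw [ENNReal.rpow_natCast, ← nonpos_iff_eq_zero]
    refine (pow_le_pow_left' (hdiam n b) k).trans_eq ?_
    rw [mul_pow, hk, mul_zero]
  calc ∑' b : u n, Metric.ediam (Metric.eball (b : X) (3 * ENNReal.ofReal (r n b))) ^ (k : ℝ)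
      ≤ ∑' b : u n, 6 ^ k * (C⁻¹ * (C * ENNReal.ofReal (r n b) ^ k)) := by
        refine ENNReal.tsum_le_tsum fun b => ?_
        rw [ENNReal.rpow_natCast, ← mul_assoc C⁻¹, ENNReal.inv_mul_cancel hC hC', one_mul,
          ← mul_pow]
        exact pow_le_pow_left' (hdiam n b) k
    _ = 6 ^ k * (C⁻¹ * ∑' b : u n, C * ENNReal.ofReal (r n b) ^ k) := by
        rw [ENNReal.tsum_mul_left, ENNReal.tsum_mul_left]
    _ ≤ 6 ^ k * (C⁻¹ * ν V) := by gcongr; exact hsum n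

/-! ### Superadditivity of mass -/

section Superadditivity

variable {E M : Type*} [NormedAddCommGroup E] [NormedSpace ℝ E]
  [TopologicalSpace M] [ChartedSpace E M] {k : ℕ}

lemma RoughForm.eq_zero_of_notMem_supp {φ : RoughForm E M k} {x : M} (hx : x ∉ φ.supp) :
    φ x = 0 := by
  by_contra h
  exact hx (subset_closure h)

lemma RoughForm.supp_smul_add_smul_subset (z w : ℂ) (φ ψ : RoughForm E M k) :
    (z • φ + w • ψ).supp ⊆ φ.supp ∪ ψ.supp := by
  refine closure_minimal (fun x hx => ?_) (isClosed_closure.union isClosed_closure)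
  by_contra h
  rw [mem_union, not_or] at h
  refine hx ?_
  rw [Pi.add_apply, Pi.smul_apply, Pi.smul_apply, eq_zero_of_notMem_supp h.1,
    eq_zero_of_notMem_supp h.2]
  ext v
  simp

variable [RiemannianBundle (fun x : M => TangentSpace 𝓘(ℝ, E) x)]

lemma comass_smul_of_norm_eq_one {x : M} {z : ℂ} (hz : ‖z‖ = 1)
    (α : TangentSpace 𝓘(ℝ, E) x [⋀^Fin k]→L[ℝ] ℂ) : comass (z • α) = comass α := by
  have hz' : ‖z‖ₑ = 1 := by rw [← ofReal_norm, hz, ENNReal.ofReal_one]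
  simp [comass, enorm_mul, hz']

namespace Current

lemma massOn_mono (T : Current E M k) {U V : Set M} (h : U ⊆ V) : T.massOn U ≤ T.massOn V :=
  iSup_mono fun _ => iSup_le fun hU => le_iSup_of_le (hU.trans h) le_rfl

lemma massMeasure_of_isOpen (T : Current E M k) {U : Set M} (hU : IsOpen U) :
    T.massMeasure U = T.massOn U :=
  le_antisymm (iInf_le_of_le U (iInf₂_le_of_le hU Subset.rfl le_rfl))
    (le_iInf fun _ => le_iInf₂ fun _ h => T.massOn_mono h)

lemma massOn_eq_iSup_and (T : Current E M k) (U : Set M) :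
    T.massOn U = ⨆ (φ : testForms E M k)
      (_ : φ.1.supp ⊆ U ∧ ∀ x, comass (φ.1 x) ≤ 1), ‖T.toLinearMap φ‖ₑ := by
  simp only [massOn, iSup_and]

/-- Makes the suprema defining mass range over nonempty families, as needed to add two of them. -/
lemma zero_admissible (U : Set M) : (0 : testForms E M k).1.supp ⊆ U ∧
    ∀ x, comass ((0 : testForms E M k).1 x) ≤ 1 :=
  ⟨by simp [RoughForm.supp], fun x => by simp [comass]⟩

/-- The mass of a current is superadditive on disjoint sets. -/
lemma massOn_add_le (T : Current E M k) {U V : Set M} (h : Disjoint U V) :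
    T.massOn U + T.massOn V ≤ T.massOn (U ∪ V) := by
  rw [T.massOn_eq_iSup_and U, T.massOn_eq_iSup_and V]
  refine ENNReal.biSup_add_biSup_le' ⟨0, zero_admissible U⟩ ⟨0, zero_admissible V⟩ ?_
  rintro φ ⟨hφU, hφ⟩ ψ ⟨hψV, hψ⟩
  obtain ⟨z, hz, hzφ⟩ := RCLike.exists_norm_eq_mul_self (T.toLinearMap φ)
  obtain ⟨w, hw, hwψ⟩ := RCLike.exists_norm_eq_mul_self (T.toLinearMap ψ)
  have hsupp : (z • φ + w • ψ).1.supp ⊆ U ∪ V :=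
    (RoughForm.supp_smul_add_smul_subset z w φ.1 ψ.1).trans (union_subset_union hφU hψV)
  -- At each point at most one summand is nonzero, and a unimodular factor preserves comass.
  have hcomass : ∀ x, comass ((z • φ + w • ψ).1 x) ≤ 1 := by
    intro x
    change comass (z • φ.1 x + w • ψ.1 x) ≤ 1
    by_cases hx : x ∈ U
    · have h0 : w • ψ.1 x = 0 := by
        rw [RoughForm.eq_zero_of_notMem_supp fun hxV => h.notMem_of_mem_left hx (hψV hxV)]
        ext v
        simp
      rw [h0, add_zero, comass_smul_of_norm_eq_one hz]
      exact hφ x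
    · have h0 : z • φ.1 x = 0 := by
        rw [RoughForm.eq_zero_of_notMem_supp fun hxU => hx (hφU hxU)]
        ext v
        simp
      rw [h0, zero_add, comass_smul_of_norm_eq_one hw]
      exact hψ x
  -- After the rotations both values are nonnegative reals, so the triangle inequality is an
  -- equality.
  have hval : ‖T.toLinearMap φ‖ₑ + ‖T.toLinearMap ψ‖ₑ = ‖T.toLinearMap (z • φ + w • ψ)‖ₑ := by
    rw [map_add, map_smul, map_smul, smul_eq_mul, smul_eq_mul, ← hzφ, ← hwψ, ← ofReal_norm,
      ← ofReal_norm, ← ofReal_norm, ← ENNReal.ofReal_add (norm_nonneg _) (norm_nonneg _)]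
    congr 1
    have h1 : ‖((‖T.toLinearMap φ‖ + ‖T.toLinearMap ψ‖ : ℝ) : ℂ)‖ =
        ‖T.toLinearMap φ‖ + ‖T.toLinearMap ψ‖ :=
      Complex.norm_of_nonneg (by positivity)
    rw [← h1]
    push_cast
    rfl
  rw [hval]
  exact le_iSup_of_le (z • φ + w • ψ) (le_iSup₂_of_le hsupp hcomass le_rfl)

lemma sum_massOn_le {ι : Type*} (T : Current E M k) (F : Finset ι) (U : ι → Set M)
    (h : (F : Set ι).PairwiseDisjoint U) :
    ∑ i ∈ F, T.massOn (U i) ≤ T.massOn (⋃ i ∈ F, U i) := by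
  classical
  induction F using Finset.induction_on with
  | empty => simp
  | insert a F ha ih =>
    rw [Finset.sum_insert ha, Finset.set_biUnion_insert]
    rw [Finset.coe_insert] at h
    refine (add_le_add_right (ih (h.subset (subset_insert _ _))) _).trans (T.massOn_add_le ?_)
    refine disjoint_iUnion₂_right.2 fun i hi => ?_
    exact h (mem_insert _ _) (mem_insert_of_mem _ hi) (fun hai => ha (hai ▸ hi))

lemma LocallyNormal.locallyFiniteMass [IsManifold 𝓘(ℝ, E) ∞ M] {T : Current E M k}
    (hT : T.LocallyNormal) : T.LocallyFiniteMass := by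
  cases k with
  | zero => exact hT
  | succ k => exact hT.1

end Current

end Superadditivity

/-! ### Support, density and the main theorem -/

lemma Current.isClosed_support {E M : Type*} [NormedAddCommGroup E] [NormedSpace ℝ E]
    [TopologicalSpace M] [ChartedSpace E M] {k : ℕ} (T : Current E M k) :
    IsClosed T.support := by
  refine isClosed_iff_nhds.2 fun a ha U hU haU => ?_
  obtain ⟨b, hbU, hb⟩ := ha U (hU.mem_nhds haU)
  exact hb U hU hbU

/-- Strictness of `c < θ` lets the limit control the ratio at all small radii; `θ = ⊤` is included.
-/
lemma Current.HasDensity.eventually_le_massMeasure {E M : Type*} [NormedAddCommGroup E]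
    [NormedSpace ℝ E] [EMetricSpace M] [ChartedSpace E M]
    [RiemannianBundle (fun x : M => TangentSpace 𝓘(ℝ, E) x)] {k : ℕ}
    {T : Current E M k} {a : M} {θ c : ℝ≥0∞} (h : T.HasDensity a θ) (hc : c < θ) :
    ∀ᶠ r : ℝ in 𝓝[>] 0,
      c * volume (Metric.ball (0 : EuclideanSpace ℝ (Fin k)) 1) * ENNReal.ofReal r ^ k ≤
        T.massMeasure (Metric.eball a (ENNReal.ofReal r)) := by
  filter_upwards [h.eventually (lt_mem_nhds hc), self_mem_nhdsWithin] with r hr hr0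
  rw [mul_assoc, ← ENNReal.ofReal_pow (le_of_lt hr0)]
  exact (ENNReal.mul_lt_of_lt_div hr).le

theorem mainTheorem12 (n k : ℕ) (M : Type*) [EMetricSpace M] [MeasurableSpace M] [BorelSpace M]
    [ChartedSpace (EuclideanSpace ℝ (Fin n)) M] [IsManifold (𝓡 n) ∞ M]
    [RiemannianBundle (fun x : M => TangentSpace (𝓡 n) x)]
    [IsContMDiffRiemannianBundle (𝓡 n) ∞ (EuclideanSpace ℝ (Fin n))
      (fun x : M => TangentSpace (𝓡 n) x)]
    [IsRiemannianManifold (𝓡 n) M]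
    (T : Current (EuclideanSpace ℝ (Fin n)) M k) (hT : T.LocallyNormal)
    (c : ℝ) (hc : 0 < c)
    (hdens : ∀ᵐ a ∂(μH[(k : ℝ)] : Measure M), a ∈ T.support →
      ∃ θ : ℝ≥0∞, ENNReal.ofReal c ≤ θ ∧ T.HasDensity a θ) :
    HausdorffLocallyFinite k T.support := by
  refine ⟨(le_toOuterMeasure_caratheodory _) _ T.isClosed_support.measurableSet, fun a => ?_⟩
  obtain ⟨V, hV, haV, hVfin⟩ := hT.locallyFiniteMass a
  refine ⟨V, hV, haV, ?_⟩
  -- No measurability of `A` is needed: the covering estimate bounds the outer measure of any set.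
  set A : Set M := {a | a ∈ V ∧ ∃ θ : ℝ≥0∞, ENNReal.ofReal c ≤ θ ∧ T.HasDensity a θ}
  have hA : μH[(k : ℝ)] A < ⊤ := by
    refine hausdorffMeasure_lt_top_of_superadditive k T.massMeasure
      -- Halving `c` gives a constant strictly below every admissible density.
      (C := ENNReal.ofReal (c / 2) * volume (Metric.ball (0 : EuclideanSpace ℝ (Fin k)) 1))
      hV ?_ hVfin (fun _ h => h.1) ?_ ?_
    · exact mul_ne_zero (ENNReal.ofReal_pos.2 (by positivity)).ne'
        (Metric.measure_ball_pos volume _ one_pos).ne'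
    · intro F U hFU hU
      rw [T.massMeasure_of_isOpen hV,
        Finset.sum_congr rfl fun i hi => T.massMeasure_of_isOpen (hU i hi).1]
      exact (T.sum_massOn_le F U hFU).trans
        (T.massOn_mono (iUnion₂_subset fun i hi => (hU i hi).2))
    · rintro a ⟨-, θ, hθ, hd⟩
      exact hd.eventually_le_massMeasure
        (((ENNReal.ofReal_lt_ofReal_iff hc).2 (half_lt_self hc)).trans_le hθ)
  -- The points of the support in `V` outside `A` form a null set by the density hypothesis.
  refine (measure_mono_ae ?_).trans_lt hA
  filter_upwards [hdens] with x hx hxV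
  exact ⟨hxV.1, hx hxV.2⟩
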